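/- Let $k$ be a positive integer and $\rho\in(0,1)$. A $k$-CNF formula is a conjunction of clauses, each of which is a disjunction of at most $k$ literals (an empty clause is false, an empty formula is true). For a CNF formula $\varphi$ on $n$ Boolean variables let $\#\mathrm{SAT}(\varphi)$ be the number of assignments in $\{0,1\}^n$ that satisfy $\varphi$, and let the size $|\varphi|$ be the sum of the widths (numbers of literals) of the clauses of $\varphi$. The problem $\mathrm{Thr}_\rho$-$k\mathrm{SAT}$ is: given a $k$-CNF formula $\varphi$ on $n$ variables, decide whether $\#\mathrm{SAT}(\varphi)\ge\rho\cdot 2^n$. **Theorem.** For every positive integer $M$ and every rational $\rho\in(0,1)$ whose denominator (in lowest terms) is at most $M$, the problem $\mathrm{Thr}_\rho$-$3\mathrm{SAT}$ can be solved deterministically in time linear in the size of the formula, with a constant that depends only on $M$. Precisely: for every $M$ there is a constant $C=C(M)$ such that for every such $\rho$ there is a deterministic random access machine program which, on every $3$-CNF formula $\varphi$ with any number $n$ of variables, correctly decides whether $\#\mathrm{SAT}(\varphi)\ge\rho\cdot 2^n$ within $C\cdot(|\varphi|+1)$ steps. The machine has random access to its input, the list of words consisting of $n$, the number of clauses, and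 for each clause its width followed by the variable and the sign of each of its literals; its instructions, at unit cost, are constants, addition, truncated subtraction, indirect load and store, reading an input word, and tests for zero; and all the numbers it handles are at most $C\cdot(n+L)$, where $L$ is the length of this list (words of $\log_2(n+L)+O_M(1)$ bits). -/

import Mathlib

namespace ThresholdSAT

/-- A literal over the variables `0, …, n - 1`: the pair `(v, true)` is the variable `v`,
the pair `(v, false)` is its negation. -/
abbrev Literal (n : ℕ) := Fin n × Bool

/-- A clause is a disjunction of literals; the empty clause is false. -/
abbrev Clause (n : ℕ) := List (Literal n)

/-- A CNF formula on `n` variables is a conjunction of clauses; the empty formula is true. -/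
abbrev CNF (n : ℕ) := List (Clause n)

/-- The assignment `a` satisfies the formula `φ`: every clause of `φ` contains a literal that
`a` makes true. -/
def Satisfies {n : ℕ} (a : Fin n → Bool) (φ : CNF n) : Prop :=
  ∀ c ∈ φ, ∃ l ∈ c, a l.1 = l.2

instance {n : ℕ} (a : Fin n → Bool) (φ : CNF n) : Decidable (Satisfies a φ) := by
  unfold Satisfies; infer_instance

/-- The number of satisfying assignments of `φ`, among all `2 ^ n` assignments. -/
def numSat {n : ℕ} (φ : CNF n) : ℕ :=
  (Finset.univ.filter fun a : Fin n → Bool => Satisfies a φ).card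

/-- Every clause has width at most `k`. -/
def IsKCNF {n : ℕ} (k : ℕ) (φ : CNF n) : Prop :=
  ∀ c ∈ φ, c.length ≤ k

/-- The size `|φ|` of a formula: the sum of the widths of its clauses. -/
def size {n : ℕ} (φ : CNF n) : ℕ :=
  (φ.map List.length).sum

/-- A literal is written as two words, its variable and its sign. -/
def encodeLiteral {n : ℕ} (l : Literal n) : List ℕ :=
  [l.1.val, l.2.toNat]

/-- A clause is written as its width, followed by its literals. -/
def encodeClause {n : ℕ} (c : Clause n) : List ℕ :=
  c.length :: c.flatMap encodeLiteral

/-- A formula is written as the number of variables, the number of clauses, and the clauses. -/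
def encode {n : ℕ} (φ : CNF n) : List ℕ :=
  n :: φ.length :: φ.flatMap encodeClause

/-- Programs of a random access machine, in structured form. The machine has registers (of which
a program uses a fixed finite number), a memory that is addressed by the contents of
registers, and a read-only random access input. -/
inductive Program : Type
  /-- do nothing -/
  | skip : Program
  /-- `r := c` -/
  | const (r c : ℕ) : Program
  /-- `r := a + b` -/
  | add (r a b : ℕ) : Program
  /-- `r := a - b`, truncated at zero -/
  | sub (r a b : ℕ) : Program
  /-- `r := memory[a]` -/
  | load (r a : ℕ) : Program
  /-- `memory[a] := b` -/
  | store (a b : ℕ) : Program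
  /-- `r := input[a]` -/
  | read (r a : ℕ) : Program
  /-- first `p`, then `q` -/
  | seq (p q : Program) : Program
  /-- if register `a` is nonzero then `p` else `q` -/
  | branch (a : ℕ) (p q : Program) : Program
  /-- while register `a` is nonzero do `p` -/
  | loop (a : ℕ) (p : Program) : Program

/-- The contents of the registers and of the memory. -/
structure State where
  reg : ℕ → ℕ
  mem : ℕ → ℕ

/-- At the start all registers and all memory cells hold `0`. -/
def State.init : State := ⟨fun _ => 0, fun _ => 0⟩

def State.setReg (s : State) (r v : ℕ) : State :=
  { s with reg := Function.update s.reg r v }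

def State.setMem (s : State) (a v : ℕ) : State :=
  { s with mem := Function.update s.mem a v }

/-- `Exec B x p s t s'`: on the machine whose words are the numbers `0, …, B`, with input `x`,
the program `p` started in the state `s` halts after exactly `t` steps in the state `s'`.
Every instruction and every evaluation of a test is one step. An instruction whose result does
not fit into a word cannot be executed. Input positions beyond the end of `x` read as `0`. -/
inductive Exec (B : ℕ) (x : List ℕ) : Program → State → ℕ → State → Prop
  | skip (s : State) : Exec B x .skip s 1 s
  | const (r c : ℕ) (s : State) (h : c ≤ B) :
      Exec B x (.const r c) s 1 (s.setReg r c)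
  | add (r a b : ℕ) (s : State) (h : s.reg a + s.reg b ≤ B) :
      Exec B x (.add r a b) s 1 (s.setReg r (s.reg a + s.reg b))
  | sub (r a b : ℕ) (s : State) :
      Exec B x (.sub r a b) s 1 (s.setReg r (s.reg a - s.reg b))
  | load (r a : ℕ) (s : State) :
      Exec B x (.load r a) s 1 (s.setReg r (s.mem (s.reg a)))
  | store (a b : ℕ) (s : State) :
      Exec B x (.store a b) s 1 (s.setMem (s.reg a) (s.reg b))
  | read (r a : ℕ) (s : State) (h : x.getD (s.reg a) 0 ≤ B) :
      Exec B x (.read r a) s 1 (s.setReg r (x.getD (s.reg a) 0))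
  | seq (p q : Program) (s s' s'' : State) (t u : ℕ)
      (hp : Exec B x p s t s') (hq : Exec B x q s' u s'') :
      Exec B x (.seq p q) s (t + u) s''
  | branch_nonzero (a : ℕ) (p q : Program) (s s' : State) (t : ℕ)
      (ha : s.reg a ≠ 0) (hp : Exec B x p s t s') :
      Exec B x (.branch a p q) s (t + 1) s'
  | branch_zero (a : ℕ) (p q : Program) (s s' : State) (t : ℕ)
      (ha : s.reg a = 0) (hq : Exec B x q s t s') :
      Exec B x (.branch a p q) s (t + 1) s'
  | loop_zero (a : ℕ) (p : Program) (s : State) (ha : s.reg a = 0) :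
      Exec B x (.loop a p) s 1 s
  | loop_nonzero (a : ℕ) (p : Program) (s s' s'' : State) (t u : ℕ)
      (ha : s.reg a ≠ 0) (hp : Exec B x p s t s') (hl : Exec B x (.loop a p) s' u s'') :
      Exec B x (.loop a p) s (t + u + 1) s''

/-- With words `0, …, B` and on input `x`, the program halts within `T` steps, with the answer
to the question `Q` in register `0`: `1` if `Q` holds, `0` if it does not. -/
def Program.Answers (p : Program) (B : ℕ) (x : List ℕ) (T : ℕ) (Q : Prop) : Prop :=
  ∃ t s, t ≤ T ∧ Exec B x p State.init t s ∧
    (Q → s.reg 0 = 1) ∧ (¬ Q → s.reg 0 = 0)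

/-- The program solves the threshold problem for `ρ` and `k`: given a `k`-CNF formula `φ` on `n`
variables, decide whether `φ` has at least `ρ * 2 ^ n` satisfying assignments. It takes at most
`C * (|φ| + 1)` steps, on a machine whose words are the numbers up to `C * (n + L)`, where `L` is
the length of the input. -/
def Program.SolvesThr (p : Program) (ρ : ℚ) (k C : ℕ) : Prop :=
  ∀ (n : ℕ) (φ : CNF n), IsKCNF k φ →
    p.Answers (C * (n + (encode φ).length)) (encode φ) (C * (size φ + 1))
      (ρ * 2 ^ n ≤ (numSat φ : ℚ))

end ThresholdSAT

/-! For fixed `k` the satisfaction probabilities of `k`-CNF formulas cannot accumulate at `ρ` from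
below. Hence a sufficiently good approximation from below decides the threshold, and a decision tree
of constant depth supplies one.

The gap (`exists_gap`) follows from the well-ordering of the falsification probabilities
(`spectrum_isPWO`), by induction on the number `j` of free literals per unsettled clause. Many
disjoint unsettled clauses force the satisfaction probability close to `0`, so below any `y < 1` the
falsification probability excludes them. Then boundedly many variables meet every clause with the
maximal number of free literals. Branching on these variables writes the probability as a boundedly
iterated average of values for `j - 1`, and averaging preserves partial well-ordering.

The tree branches on free variables of the first unsettled clause and counts the satisfied leaves.
Every `k` levels shrink the missed probability by the factor `1 - 2 ^ (-k)` (`treeError_le_pow`), so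
some depth depending only on `k` and `ρ` brings the error below the gap
(`exists_treeCount_threshold`).

Each of the boundedly many nodes costs one linear scan of the formula (`runs_scanProgram`). As only
finitely many `ρ` have denominator at most `M`, one constant serves them all. -/

namespace ThresholdSAT

/-! ### Partial assignments -/

section Partial

variable {n : ℕ}

/-- A partial assignment; `none` marks the free variables. -/
abbrev PAssign (n : ℕ) := Fin n → Option Bool

/-- The assignment that follows `α` where it is defined and `a` elsewhere. -/
def extend (α : PAssign n) (a : Fin n → Bool) : Fin n → Bool := fun v => (α v).getD (a v)

/-- The partial assignment `α` with `v` set to `b`. -/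
def assign (α : PAssign n) (v : Fin n) (b : Bool) : PAssign n := Function.update α v (some b)

/-- The probability that a random extension of `α` satisfies `φ`. -/
def prob (φ : CNF n) (α : PAssign n) : ℚ :=
  ((Finset.univ.filter fun a : Fin n → Bool => Satisfies (extend α a) φ).card : ℚ) / 2 ^ n

/-- The clause is made true by `α`, or it is a tautology. -/
def Settled (α : PAssign n) (c : Clause n) : Prop :=
  (∃ l ∈ c, α l.1 = some l.2) ∨ ∃ l ∈ c, (l.1, !l.2) ∈ c

instance (α : PAssign n) (c : Clause n) : Decidable (Settled α c) := by
  unfold Settled; infer_instance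

/-- The number of literals of a clause whose variable is free. -/
def freeCount (α : PAssign n) (c : Clause n) : ℕ := c.countP fun l => α l.1 = none

theorem assign_self (α : PAssign n) (v : Fin n) (b : Bool) : assign α v b v = some b := by
  simp [assign]

theorem assign_of_ne (α : PAssign n) {v w : Fin n} (b : Bool) (h : w ≠ v) :
    assign α v b w = α w := by
  simp [assign, h]

theorem prob_none (φ : CNF n) : prob φ (fun _ => none) = numSat φ / 2 ^ n := by
  have h : ∀ a : Fin n → Bool, extend (fun _ => none) a = a := fun _ => rfl
  simp [prob, numSat, h]

theorem prob_nonneg (φ : CNF n) (α : PAssign n) : 0 ≤ prob φ α := by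
  unfold prob; positivity

theorem prob_le_one (φ : CNF n) (α : PAssign n) : prob φ α ≤ 1 := by
  unfold prob
  rw [div_le_one (by positivity)]
  refine le_trans (Nat.cast_le.2 (Finset.card_le_univ _)) ?_
  simp

theorem prob_eq_one {φ : CNF n} {α : PAssign n} (h : ∀ a, Satisfies (extend α a) φ) :
    prob φ α = 1 := by
  unfold prob
  rw [Finset.filter_true_of_mem fun a _ => h a]
  simp

theorem prob_eq_zero {φ : CNF n} {α : PAssign n} (h : ∀ a, ¬ Satisfies (extend α a) φ) :
    prob φ α = 0 := by
  unfold prob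
  rw [Finset.filter_false_of_mem fun a _ => h a]
  simp

/-- Once `v` is fixed to `b`, the value `a v` no longer matters, so the assignments counted for
`assign α v b` come in pairs that differ only at `v`. Each pair has one member with `a v = b`. -/
theorem prob_branch (φ : CNF n) {α : PAssign n} {v : Fin n} (hv : α v = none) :
    prob φ α = (prob φ (assign α v false) + prob φ (assign α v true)) / 2 := by
  have ext_assign : ∀ b a, extend (assign α v b) a = extend α (Function.update a v b) := by
    intro b a
    funext w
    by_cases h : w = v
    · subst h; simp [extend, assign, hv]
    · simp [extend, assign, h]
  have key : ∀ b, (Finset.univ.filter fun a : Fin n → Bool =>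
      Satisfies (extend (assign α v b) a) φ).card =
      2 * (Finset.univ.filter fun a : Fin n → Bool =>
        Satisfies (extend α a) φ ∧ a v = b).card := by
    intro b
    rw [← Finset.card_filter_add_card_filter_not (fun a : Fin n → Bool => a v = b), two_mul]
    congr 1
    · congr 1
      ext a
      simp only [Finset.mem_filter, Finset.mem_univ, true_and, ext_assign]
      constructor
      · rintro ⟨h, rfl⟩; simpa using h
      · rintro ⟨h, rfl⟩; simpa using h
    · refine Finset.card_bij' (fun a _ => Function.update a v b)
        (fun a _ => Function.update a v (!b)) ?_ ?_ ?_ ?_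
      · intro a ha
        simp only [Finset.mem_filter, Finset.mem_univ, true_and, ext_assign] at ha ⊢
        exact ⟨ha.1, by simp⟩
      · intro a ha
        simp only [Finset.mem_filter, Finset.mem_univ, true_and, ext_assign] at ha ⊢
        obtain ⟨h, rfl⟩ := ha
        simpa using h
      · intro a ha
        simp only [Finset.mem_filter, Finset.mem_univ, true_and] at ha
        have : (!b) = a v := by rcases b <;> simp_all
        simp [this]
      · intro a ha
        simp only [Finset.mem_filter, Finset.mem_univ, true_and] at ha
        simp [← ha.2]
  have split := Finset.card_filter_add_card_filter_not
    (s := Finset.univ.filter fun a : Fin n → Bool => Satisfies (extend α a) φ)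
    (fun a : Fin n → Bool => a v = false)
  simp only [Finset.filter_filter, Bool.not_eq_false] at split
  unfold prob
  rw [key, key, ← split]
  push_cast
  ring

theorem Settled.satisfied {α : PAssign n} {c : Clause n} (h : Settled α c) (a : Fin n → Bool) :
    ∃ l ∈ c, extend α a l.1 = l.2 := by
  rcases h with ⟨l, hl, h⟩ | ⟨l, hl, h⟩
  · exact ⟨l, hl, by simp [extend, h]⟩
  · by_cases h' : extend α a l.1 = l.2
    · exact ⟨l, hl, h'⟩
    · exact ⟨_, h, by revert h'; cases extend α a l.1 <;> cases l.2 <;> simp⟩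

theorem not_satisfied_of_freeCount_eq_zero {α : PAssign n} {c : Clause n} (h : ¬ Settled α c)
    (h0 : freeCount α c = 0) (a : Fin n → Bool) : ¬ ∃ l ∈ c, extend α a l.1 = l.2 := by
  rintro ⟨l, hl, hla⟩
  have := List.countP_eq_zero.1 h0 l hl
  simp only [decide_eq_true_eq] at this
  obtain ⟨b, hb⟩ := Option.ne_none_iff_exists'.1 this
  exact h (.inl ⟨l, hl, by simpa [extend, hb] using hla⟩)

/-- `β` differs from `α` only at free variables of `c`. -/
def DiffersIn (α β : PAssign n) (c : Clause n) : Prop :=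
  ∀ w, β w ≠ α w → α w = none ∧ ∃ l ∈ c, l.1 = w

theorem Settled.mono {α β : PAssign n} {c : Clause n} (h : Settled α c)
    (hβ : ∀ w, α w ≠ none → β w = α w) : Settled β c := by
  rcases h with ⟨l, hl, h⟩ | h
  · exact .inl ⟨l, hl, by rw [hβ _ (by simp [h]), h]⟩
  · exact .inr h

theorem freeCount_mono {α β : PAssign n} (c : Clause n)
    (hβ : ∀ w, α w ≠ none → β w = α w) : freeCount β c ≤ freeCount α c := by
  refine List.countP_mono_left fun l _ h => ?_
  simp only [decide_eq_true_eq] at h ⊢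
  by_contra h'
  exact h' (hβ _ h' ▸ h)

theorem assign_extends {α : PAssign n} {v : Fin n} (hv : α v = none) (b : Bool) (w : Fin n)
    (h : α w ≠ none) : assign α v b w = α w :=
  assign_of_ne α b fun e => h (e ▸ hv)

theorem freeCount_assign_lt {α : PAssign n} {c : Clause n} {l : Literal n} (hl : l ∈ c)
    (hf : α l.1 = none) (b : Bool) : freeCount (assign α l.1 b) c < freeCount α c := by
  unfold freeCount
  rw [List.countP_eq_length_filter, List.countP_eq_length_filter]
  have : (c.filter fun l' => decide (assign α l.1 b l'.1 = none)) =
      (c.filter fun l' => decide (α l'.1 = none)).filter fun l' => decide (l'.1 ≠ l.1) := by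
    rw [List.filter_filter]
    refine List.filter_congr fun l' _ => ?_
    by_cases h : l'.1 = l.1
    · simp [h, assign_self]
    · simp [h, assign_of_ne α b h]
  rw [this, List.length_filter_lt_length_iff_exists]
  exact ⟨l, by simp [hl, hf], by simp⟩

/-- A literal that becomes true when `l` is made false must be the complement of `l`, and then the
clause is a tautology. This is why `Settled` includes tautologies. -/
theorem not_settled_assign {α : PAssign n} {c : Clause n} (h : ¬ Settled α c) {l : Literal n}
    (hl : l ∈ c) : ¬ Settled (assign α l.1 (!l.2)) c := by
  rintro (⟨l', hl', h'⟩ | h')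
  · by_cases e : l'.1 = l.1
    · rw [e, assign_self] at h'
      refine h (.inr ⟨l, hl, ?_⟩)
      have : l' = (l.1, !l.2) := Prod.ext e (by simpa using h'.symm)
      exact this ▸ hl'
    · rw [assign_of_ne _ _ e] at h'
      exact h (.inl ⟨l', hl', h'⟩)
  · exact h (.inr h')

/-! ### The spectrum of satisfaction probabilities is well-ordered -/

/-- At least one of the at most `2 ^ j` settings of the free variables of `c` falsifies `c` and
contributes nothing. In the induction, falsifying one free literal leaves `c` unsettled with fewer
free literals, while the other branch is bounded by `e`. -/
theorem prob_le_of_clause {φ : CNF n} {c : Clause n} (hc : c ∈ φ) {e : ℚ} (he : 0 ≤ e) (j : ℕ) :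
    ∀ α : PAssign n, ¬ Settled α c → freeCount α c ≤ j →
      (∀ β, DiffersIn α β c → prob φ β ≤ e) → prob φ α ≤ (1 - (1 / 2) ^ j) * e := by
  have zero : ∀ α : PAssign n, ¬ Settled α c → freeCount α c = 0 → prob φ α = 0 :=
    fun α hs h0 => prob_eq_zero fun a ha => not_satisfied_of_freeCount_eq_zero hs h0 a (ha c hc)
  induction j with
  | zero =>
    intro α hs hj _
    simp [zero α hs (Nat.le_zero.1 hj)]
  | succ j ih =>
    intro α hs hj hβ
    rcases Nat.eq_zero_or_pos (freeCount α c) with h0 | h0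
    · rw [zero α hs h0]
      have : ((1 : ℚ) / 2) ^ (j + 1) ≤ 1 := pow_le_one₀ (by norm_num) (by norm_num)
      exact mul_nonneg (by linarith) he
    · obtain ⟨l, hl, hf⟩ := List.countP_pos_iff.1 h0
      simp only [decide_eq_true_eq] at hf
      have differs : ∀ b, DiffersIn α (assign α l.1 b) c := by
        intro b w hw
        by_cases e : w = l.1
        · exact ⟨e ▸ hf, l, hl, e.symm⟩
        · exact absurd (assign_of_ne _ _ e) hw
      have h1 := ih (assign α l.1 (!l.2)) (not_settled_assign hs hl)
        (by have := freeCount_assign_lt hl hf (!l.2); omega) (by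
          intro β h
          refine hβ β fun w hw => ?_
          by_cases e : β w = assign α l.1 (!l.2) w
          · exact differs (!l.2) w (e ▸ hw)
          · obtain ⟨h1, h2⟩ := h w e
            refine ⟨?_, h2⟩
            by_contra h3
            exact h3 (assign_extends hf _ w h3 ▸ h1))
      have h2 := hβ _ (differs l.2)
      have h3 : prob φ α = (prob φ (assign α l.1 (!l.2)) + prob φ (assign α l.1 l.2)) / 2 := by
        rw [prob_branch φ hf]
        cases l.2
        · rw [add_comm]; rfl
        · rfl
      rw [h3, pow_succ]
      linarith

/-- The clauses `c` and `d` have no free variable in common. -/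
def FreeDisjoint (α : PAssign n) (c d : Clause n) : Prop :=
  ∀ l ∈ c, α l.1 = none → ∀ l' ∈ d, l'.1 ≠ l.1

/-- Setting free variables of the first clause does not touch the other clauses, so the factors of
`prob_le_of_clause` multiply. -/
theorem prob_le_of_disjoint {φ : CNF n} (j : ℕ) (cs : List (Clause n)) :
    ∀ α : PAssign n, (∀ c ∈ cs, c ∈ φ ∧ ¬ Settled α c ∧ freeCount α c ≤ j) →
      cs.Pairwise (FreeDisjoint α) → prob φ α ≤ (1 - (1 / 2) ^ j) ^ cs.length := by
  have hq : (0 : ℚ) ≤ 1 - (1 / 2) ^ j :=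
    sub_nonneg.2 (pow_le_one₀ (by norm_num) (by norm_num))
  induction cs with
  | nil => intro α _ _; simpa using prob_le_one φ α
  | cons c cs ih =>
    intro α h hp
    rw [List.pairwise_cons] at hp
    obtain ⟨hc, hs, hf⟩ := h c (by simp)
    rw [List.length_cons, pow_succ']
    refine prob_le_of_clause hc (pow_nonneg hq _) j α hs hf fun β hβ => ih β ?_ ?_
    · intro d hd
      obtain ⟨h1, h2, h3⟩ := h d (by simp [hd])
      have same : ∀ l ∈ d, β l.1 = α l.1 := by
        intro l hl
        by_contra e
        obtain ⟨h4, l', hl', h5⟩ := hβ _ e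
        exact hp.1 d hd l' hl' (h5 ▸ h4) l hl h5.symm
      refine ⟨h1, ?_, ?_⟩
      · rintro (⟨l, hl, h4⟩ | h4)
        · exact h2 (.inl ⟨l, hl, same l hl ▸ h4⟩)
        · exact h2 (.inr h4)
      · refine le_trans (freeCount_mono d fun w hw => ?_) h3
        by_contra e
        exact hw (hβ w e).1
    · refine hp.2.imp fun hcd l hl hβl => hcd l hl ?_
      by_contra e
      have : β l.1 = α l.1 := by
        by_contra e'
        exact e (hβ _ e').1
      exact e (this ▸ hβl)

/-- Either there are `m` disjoint unsettled clauses with free variables, or a small set of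
variables meets all of them. -/
theorem exists_disjoint_or_hitting (φ : CNF n) (α : PAssign n) (j : ℕ)
    (hφ : ∀ c ∈ φ, Settled α c ∨ freeCount α c ≤ j + 1) (m : ℕ) :
    (∃ cs : List (Clause n), cs.length = m ∧ cs.Pairwise (FreeDisjoint α) ∧
      ∀ c ∈ cs, c ∈ φ ∧ ¬ Settled α c ∧ freeCount α c ≤ j + 1) ∨
    ∃ V : List (Fin n), V.length ≤ m * (j + 1) ∧
      ∀ c ∈ φ, Settled α c ∨ freeCount α c ≤ j ∨ ∃ l ∈ c, α l.1 = none ∧ l.1 ∈ V := by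
  induction m with
  | zero => exact .inl ⟨[], by simp⟩
  | succ m ih =>
    rcases ih with ⟨cs, hlen, hp, hcs⟩ | ⟨V, hV, h⟩
    -- `V` consists of the free variables of the family. A clause that it fails to meet is disjoint
    -- from the family and enlarges it.
    · let V := cs.flatMap fun c => (c.filter fun l => α l.1 = none).map Prod.fst
      by_cases hV : ∀ c ∈ φ, Settled α c ∨ freeCount α c ≤ j ∨ ∃ l ∈ c, α l.1 = none ∧ l.1 ∈ V
      · refine .inr ⟨V, ?_, hV⟩
        have : V.length ≤ cs.length * (j + 1) := by
          simp only [V, List.length_flatMap, List.length_map]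
          rw [← smul_eq_mul]
          refine le_trans (List.sum_le_card_nsmul _ (j + 1) ?_) (by simp)
          simp only [List.mem_map]
          rintro _ ⟨c, hc, rfl⟩
          have := (hcs c hc).2.2
          rwa [freeCount, List.countP_eq_length_filter] at this
        rw [hlen] at this
        nlinarith
      · push Not at hV
        obtain ⟨c, hc, h1, -, h2⟩ := hV
        refine .inl ⟨c :: cs, by simp [hlen], List.pairwise_cons.2 ⟨?_, hp⟩, ?_⟩
        · intro d hd l hl hfree l' hl' e
          exact h2 l hl hfree (List.mem_flatMap.2 ⟨d, hd, List.mem_map.2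
            ⟨l', by simp [hl', e, hfree], e⟩⟩)
        · intro d hd
          rcases List.mem_cons.1 hd with rfl | hd
          · exact ⟨hc, h1, (hφ _ hc).resolve_left h1⟩
          · exact hcs d hd
    · exact .inr ⟨V, le_trans hV (by nlinarith), h⟩

end Partial

/-- The probabilities of falsification of formulas whose unsettled clauses have at most `j` free
literals. -/
def spectrum (j : ℕ) : Set ℚ :=
  {x | ∃ (n : ℕ) (φ : CNF n) (α : PAssign n),
    (∀ c ∈ φ, Settled α c ∨ freeCount α c ≤ j) ∧ x = 1 - prob φ α}

/-- The averages of two elements of `S`. -/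
def averages (S : Set ℚ) : Set ℚ := (fun p : ℚ × ℚ => (p.1 + p.2) / 2) '' (S ×ˢ S)

/-- The average is monotone on the product order, and products of partially well-ordered sets are
partially well-ordered. -/
theorem averages_isPWO {S : Set ℚ} (h : S.IsPWO) : (averages S).IsPWO := by
  refine (h.prod h).image_of_monotone fun p q hpq => ?_
  have h1 := hpq.1
  have h2 := hpq.2
  change (p.1 + p.2) / 2 ≤ (q.1 + q.2) / 2
  linarith

theorem subset_averages (S : Set ℚ) : S ⊆ averages S :=
  fun x hx => ⟨(x, x), ⟨hx, hx⟩, by simp⟩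

theorem iterate_averages_isPWO {S : Set ℚ} (h : S.IsPWO) (r : ℕ) : (averages^[r] S).IsPWO := by
  induction r with
  | zero => exact h
  | succ r ih => rw [Function.iterate_succ_apply']; exact averages_isPWO ih

theorem iterate_averages_mono (S : Set ℚ) : Monotone fun r => averages^[r] S :=
  monotone_nat_of_le_succ fun r => by
    rw [Function.iterate_succ_apply']; exact subset_averages _

/-- Branching on every variable of `V` removes a free literal from each clause that `V` meets, so
the leaves lie in `spectrum j`. A variable already fixed needs no branching. -/
theorem mem_iterate_averages {n : ℕ} (φ : CNF n) (j : ℕ) (V : List (Fin n)) :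
    ∀ α : PAssign n, (∀ c ∈ φ, Settled α c ∨ freeCount α c ≤ j + 1) →
      (∀ c ∈ φ, Settled α c ∨ freeCount α c ≤ j ∨ ∃ l ∈ c, α l.1 = none ∧ l.1 ∈ V) →
      1 - prob φ α ∈ averages^[V.length] (spectrum j) := by
  induction V with
  | nil =>
    intro α _ h
    exact ⟨n, φ, α, fun c hc => by simpa using h c hc, rfl⟩
  | cons v V ih =>
    intro α hk h
    by_cases hv : α v = none
    · have step : ∀ b, 1 - prob φ (assign α v b) ∈ averages^[V.length] (spectrum j) := by
        intro b
        have mono := assign_extends hv b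
        refine ih _ (fun c hc => (hk c hc).imp (fun h => h.mono mono)
          ((freeCount_mono c mono).trans)) fun c hc => ?_
        rcases h c hc with h1 | h1 | ⟨l, hl, hf, hV⟩
        · exact .inl (h1.mono mono)
        · exact .inr (.inl ((freeCount_mono c mono).trans h1))
        · by_cases e : l.1 = v
          · rcases hk c hc with h2 | h2
            · exact .inl (h2.mono mono)
            · have := freeCount_assign_lt hl hf b
              rw [e] at this
              exact .inr (.inl (by omega))
          · exact .inr (.inr ⟨l, hl, by rw [assign_of_ne _ _ e, hf],
              (List.mem_cons.1 hV).resolve_left e⟩)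
      rw [List.length_cons, Function.iterate_succ_apply']
      exact ⟨(_, _), ⟨step false, step true⟩, by rw [prob_branch φ hv]; ring⟩
    · refine iterate_averages_mono _ (Nat.le_succ _) (ih α hk fun c hc => ?_)
      refine (h c hc).imp_right (Or.imp_right ?_)
      rintro ⟨l, hl, hf, hV⟩
      refine ⟨l, hl, hf, (List.mem_cons.1 hV).resolve_left ?_⟩
      rintro rfl
      exact hv hf

theorem isPWO_of_initial {S : Set ℚ} (h1 : ∀ x ∈ S, x ≤ 1)
    (h : ∀ y < 1, (S ∩ Set.Iic y).IsPWO) : S.IsPWO := by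
  rw [Set.IsPWO, Set.partiallyWellOrderedOn_iff_exists_lt]
  intro f hf
  -- In a linear order a bad sequence is strictly decreasing, so from its third term on it stays
  -- below `f 1 < 1`.
  by_contra! hlt
  have hy : f 1 < 1 := (hlt 0 1 one_pos).trans_le (h1 _ (hf 0))
  have := h _ hy
  rw [Set.IsPWO, Set.partiallyWellOrderedOn_iff_exists_lt] at this
  obtain ⟨m, k, hmk, hle⟩ := this (fun i => f (i + 2))
    fun i => ⟨hf _, (hlt 1 (i + 2) (by omega)).le⟩
  exact absurd hle (not_le.2 (hlt _ _ (by omega)))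

theorem spectrum_isPWO (j : ℕ) : (spectrum j).IsPWO := by
  induction j with
  | zero =>
    refine Set.IsPWO.mono (Set.Finite.isPWO (Set.toFinite {0, 1})) ?_
    rintro _ ⟨n, φ, α, h, rfl⟩
    by_cases hall : ∀ c ∈ φ, Settled α c
    · left
      rw [prob_eq_one fun a c hc => (hall c hc).satisfied a, sub_self]
    · push Not at hall
      obtain ⟨c, hc, hs⟩ := hall
      right
      rw [prob_eq_zero fun a ha => not_satisfied_of_freeCount_eq_zero hs
        (Nat.le_zero.1 ((h c hc).resolve_left hs)) a (ha c hc), sub_zero]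
      rfl
  | succ j ih =>
    refine isPWO_of_initial ?_ fun y hy => ?_
    · rintro _ ⟨n, φ, α, -, rfl⟩
      linarith [prob_nonneg φ α]
    · have hq : (1 : ℚ) - (1 / 2) ^ (j + 1) < 1 := sub_lt_self _ (by positivity)
      -- With this `m`, a family of `m` disjoint clauses would give satisfaction probability below
      -- `1 - y`, so only the hitting set remains.
      obtain ⟨m, hm⟩ := exists_pow_lt_of_lt_one (sub_pos.2 hy) hq
      refine (iterate_averages_isPWO ih (m * (j + 1))).mono ?_
      rintro _ ⟨⟨n, φ, α, h, rfl⟩, hle⟩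
      rcases exists_disjoint_or_hitting φ α j h m with ⟨cs, hlen, hp, hcs⟩ | ⟨V, hV, hhit⟩
      · have := prob_le_of_disjoint (j + 1) cs α hcs hp
        rw [hlen] at this
        rw [Set.mem_Iic] at hle
        linarith
      · exact iterate_averages_mono _ hV (mem_iterate_averages φ j V α h hhit)

/-- No satisfaction probability of a `k`-CNF formula lies just below `ρ`. -/
theorem exists_gap (k : ℕ) (ρ : ℚ) : ∃ ε > 0, ∀ (n : ℕ) (φ : CNF n), IsKCNF k φ →
    (numSat φ : ℚ) / 2 ^ n < ρ → (numSat φ : ℚ) / 2 ^ n ≤ ρ - ε := by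
  have hwf : (spectrum k ∩ Set.Ioi (1 - ρ)).IsWF :=
    ((spectrum_isPWO k).mono Set.inter_subset_left).isWF
  have mem : ∀ (n : ℕ) (φ : CNF n), IsKCNF k φ → (numSat φ : ℚ) / 2 ^ n < ρ →
      1 - (numSat φ : ℚ) / 2 ^ n ∈ spectrum k ∩ Set.Ioi (1 - ρ) := by
    intro n φ hφ h
    refine ⟨⟨n, φ, fun _ => none, fun c hc => .inr ?_, by rw [prob_none]⟩, ?_⟩
    · exact le_trans List.countP_le_length (hφ c hc)
    · simp only [Set.mem_Ioi]; linarith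
  by_cases hne : (spectrum k ∩ Set.Ioi (1 - ρ)).Nonempty
  · have hmin : 1 - ρ < hwf.min hne := (hwf.min_mem hne).2
    -- The gap is the distance from `1 - ρ` to the least falsification probability above it.
    refine ⟨hwf.min hne - (1 - ρ), by linarith, fun n φ hφ h => ?_⟩
    have := hwf.min_le hne (mem n φ hφ h)
    linarith
  · exact ⟨1, one_pos, fun n φ hφ h => absurd ⟨_, mem n φ hφ h⟩ hne⟩

/-! ### Counting with a decision tree of bounded depth -/

section Tree

variable {n : ℕ}

/-- The variable of the last free literal of the clause, `u` if there is none. -/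
def lastFree (α : PAssign n) (u : Option (Fin n)) (c : Clause n) : Option (Fin n) :=
  c.foldl (fun u l => if α l.1 = none then some l.1 else u) u

theorem lastFree_eq_none (α : PAssign n) (c : Clause n) :
    ∀ u, lastFree α u c = none → u = none ∧ freeCount α c = 0 := by
  induction c with
  | nil => intro u h; exact ⟨h, rfl⟩
  | cons l c ih =>
    intro u h
    obtain ⟨h1, h2⟩ := ih _ h
    by_cases hf : α l.1 = none
    · simp [hf] at h1
    · exact ⟨by simpa [hf] using h1, by simpa [freeCount, hf] using h2⟩

theorem lastFree_eq_some (α : PAssign n) (c : Clause n) (v : Fin n) :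
    ∀ u, lastFree α u c = some v → u = some v ∨ ∃ l ∈ c, l.1 = v ∧ α v = none := by
  induction c with
  | nil => intro u h; exact .inl h
  | cons l c ih =>
    intro u h
    rcases ih _ h with h1 | ⟨l', hl', h'⟩
    · by_cases hf : α l.1 = none
      · have h2 : l.1 = v := by simpa [hf] using h1
        exact .inr ⟨l, by simp, h2, h2 ▸ hf⟩
      · exact .inl (by simpa [hf] using h1)
    · exact .inr ⟨l', by simp [hl'], h'⟩

/-- The weight of the satisfied leaves of the decision tree of depth `d` below `α`, which
always branches on a free variable of the first unsettled clause. -/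
def treeCount (φ : CNF n) : ℕ → PAssign n → ℕ
  | 0, α => match φ.find? fun c => ¬ Settled α c with
    | none => 1
    | some _ => 0
  | d + 1, α => match φ.find? fun c => ¬ Settled α c with
    | none => 2 ^ (d + 1)
    | some c => match lastFree α none c with
      | none => 0
      | some v => treeCount φ d (assign α v true) + treeCount φ d (assign α v false)

theorem treeCount_of_none {φ : CNF n} {α : PAssign n}
    (h : φ.find? (fun c => ¬ Settled α c) = none) (d : ℕ) : treeCount φ d α = 2 ^ d := by
  cases d <;> simp only [treeCount, h, pow_zero]

theorem treeCount_of_lastFree_none {φ : CNF n} {α : PAssign n} {c : Clause n}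
    (h : φ.find? (fun c => ¬ Settled α c) = some c) (hc : lastFree α none c = none) (d : ℕ) :
    treeCount φ d α = 0 := by
  cases d <;> simp only [treeCount, h, hc]

theorem treeCount_succ {φ : CNF n} {α : PAssign n} {c : Clause n} {v : Fin n}
    (h : φ.find? (fun c => ¬ Settled α c) = some c) (hc : lastFree α none c = some v) (d : ℕ) :
    treeCount φ (d + 1) α =
      treeCount φ d (assign α v true) + treeCount φ d (assign α v false) := by
  simp only [treeCount, h, hc]

theorem treeCount_le (φ : CNF n) (d : ℕ) : ∀ α : PAssign n, treeCount φ d α ≤ 2 ^ d := by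
  induction d with
  | zero => intro α; unfold treeCount; split <;> simp
  | succ d ih =>
    intro α
    unfold treeCount
    split
    · exact le_rfl
    · split
      · exact Nat.zero_le _
      · have h1 := ih (assign α ‹_› true)
        have h2 := ih (assign α ‹_› false)
        rw [pow_succ]
        omega

/-- The part of the probability that the tree of depth `d` misses. -/
def treeError (φ : CNF n) (d : ℕ) (α : PAssign n) : ℚ := prob φ α - treeCount φ d α / 2 ^ d

theorem treeError_of_none {φ : CNF n} {α : PAssign n}
    (h : φ.find? (fun c => ¬ Settled α c) = none) (d : ℕ) : treeError φ d α = 0 := by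
  rw [treeError, treeCount_of_none h, prob_eq_one]
  · simp
  · intro a c hc
    have := List.find?_eq_none.1 h c hc
    exact Settled.satisfied (by simpa using this) a

theorem treeError_of_lastFree_none {φ : CNF n} {α : PAssign n} {c : Clause n}
    (h : φ.find? (fun c => ¬ Settled α c) = some c) (hc : lastFree α none c = none) (d : ℕ) :
    treeError φ d α = 0 := by
  rw [treeError, treeCount_of_lastFree_none h hc, prob_eq_zero]
  · simp
  · intro a ha
    have hs : ¬ Settled α c := by simpa using List.find?_some h
    exact not_satisfied_of_freeCount_eq_zero hs (lastFree_eq_none α c none hc).2 a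
      (ha c (List.mem_of_find?_eq_some h))

theorem treeError_succ {φ : CNF n} {α : PAssign n} {c : Clause n} {v : Fin n}
    (h : φ.find? (fun c => ¬ Settled α c) = some c) (hc : lastFree α none c = some v) (d : ℕ) :
    treeError φ (d + 1) α =
      (treeError φ d (assign α v true) + treeError φ d (assign α v false)) / 2 := by
  have hv : α v = none := by
    rcases lastFree_eq_some α c v none hc with h | ⟨_, _, _, h⟩
    · cases h
    · exact h
  simp only [treeError, treeCount_succ h hc, prob_branch φ hv, pow_succ]
  push_cast
  field_simp
  ring

theorem treeError_nonneg (φ : CNF n) (d : ℕ) : ∀ α : PAssign n, 0 ≤ treeError φ d α := by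
  induction d with
  | zero =>
    intro α
    rcases h : φ.find? (fun c => ¬ Settled α c) with _ | c
    · rw [treeError_of_none h]
    · have : treeCount φ 0 α = 0 := by simp only [treeCount, h]
      simpa [treeError, this] using prob_nonneg φ α
  | succ d ih =>
    intro α
    rcases h : φ.find? (fun c => ¬ Settled α c) with _ | c
    · rw [treeError_of_none h]
    · rcases hc : lastFree α none c with _ | v
      · rw [treeError_of_lastFree_none h hc]
      · rw [treeError_succ h hc]
        linarith [ih (assign α v true), ih (assign α v false)]

/-- Settled clauses stay settled, so along the path that falsifies `c` the tree keeps working on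
`c`. -/
theorem find?_assign {φ : CNF n} {α : PAssign n} {c : Clause n}
    (h : φ.find? (fun c => ¬ Settled α c) = some c) {l : Literal n} (hl : l ∈ c)
    (hf : α l.1 = none) :
    φ.find? (fun c => ¬ Settled (assign α l.1 (!l.2)) c) = some c := by
  rw [List.find?_eq_some_iff_append] at h ⊢
  obtain ⟨hs, as, bs, rfl, has⟩ := h
  refine ⟨?_, as, bs, rfl, fun d hd => ?_⟩
  · have := not_settled_assign (by simpa using hs) hl
    simpa using this
  · have h1 : Settled α d := by simpa using has d hd
    have := h1.mono (assign_extends hf (!l.2))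
    simpa using this

/-- The argument of `prob_le_of_clause` applied to the error: the path that falsifies `c` ends
within `j` levels with error `0`, and every branch leaving it has error at most `e`. -/
theorem treeError_le_of_find? {φ : CNF n} {d : ℕ} {e : ℚ} (he : 0 ≤ e)
    (hd : ∀ d' ≥ d, ∀ α, treeError φ d' α ≤ e) {c : Clause n} (j : ℕ) :
    ∀ α, φ.find? (fun c => ¬ Settled α c) = some c → freeCount α c ≤ j →
      ∀ d' ≥ d, treeError φ (d' + j) α ≤ (1 - (1 / 2) ^ j) * e := by
  induction j with
  | zero =>
    intro α h hj d' _
    rcases hc : lastFree α none c with _ | v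
    · simp [treeError_of_lastFree_none h hc]
    · rcases lastFree_eq_some α c v none hc with h' | ⟨l, hl, rfl, hf⟩
      · cases h'
      · exact absurd (freeCount_assign_lt hl hf true) (by omega)
  | succ j ih =>
    intro α h hj d' hd'
    rcases hc : lastFree α none c with _ | v
    · rw [treeError_of_lastFree_none h hc]
      have : ((1 : ℚ) / 2) ^ (j + 1) ≤ 1 := pow_le_one₀ (by norm_num) (by norm_num)
      exact mul_nonneg (by linarith) he
    · rcases lastFree_eq_some α c v none hc with h' | ⟨l, hl, rfl, hf⟩
      · cases h'
      · have h1 := ih _ (find?_assign h hl hf)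
          (by have := freeCount_assign_lt hl hf (!l.2); omega) d' hd'
        have h2 := hd (d' + j) (by omega) (assign α l.1 l.2)
        rw [← add_assoc, treeError_succ h hc, pow_succ]
        cases hb : l.2 <;> simp only [hb, Bool.not_true, Bool.not_false] at h1 h2 <;> linarith

theorem treeError_le_pow {k : ℕ} {φ : CNF n} (hφ : IsKCNF k φ) (i : ℕ) :
    ∀ d ≥ i * k, ∀ α, treeError φ d α ≤ (1 - (1 / 2) ^ k) ^ i := by
  have hq : (0 : ℚ) ≤ 1 - (1 / 2) ^ k :=
    sub_nonneg.2 (pow_le_one₀ (by norm_num) (by norm_num))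
  induction i with
  | zero =>
    intro d _ α
    have : (0 : ℚ) ≤ treeCount φ d α / 2 ^ d := by positivity
    have := prob_le_one φ α
    simp only [treeError, pow_zero]
    linarith
  | succ i ih =>
    intro d hd α
    rw [Nat.succ_mul] at hd
    obtain ⟨d, rfl⟩ := Nat.exists_eq_add_of_le' (show k ≤ d by omega)
    rcases h : φ.find? (fun c => ¬ Settled α c) with _ | c
    · rw [treeError_of_none h]
      exact pow_nonneg hq _
    · rw [pow_succ']
      exact treeError_le_of_find? (pow_nonneg hq _) ih k α h
        (List.countP_le_length.trans (hφ c (List.mem_of_find?_eq_some h))) d (by omega)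

end Tree

/-- Counting with a tree of constant depth decides the threshold problem. -/
theorem exists_treeCount_threshold (k : ℕ) {ρ : ℚ} (hρ : 0 < ρ) : ∃ d N : ℕ,
    ∀ (n : ℕ) (φ : CNF n), IsKCNF k φ →
      (ρ * 2 ^ n ≤ (numSat φ : ℚ) ↔ N ≤ treeCount φ d fun _ => none) := by
  obtain ⟨ε, hε, hgap⟩ := exists_gap k ρ
  have hq : (1 : ℚ) - (1 / 2) ^ k < 1 := sub_lt_self _ (by positivity)
  obtain ⟨i, hi⟩ := exists_pow_lt_of_lt_one (lt_min hε hρ) hq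
  -- `N ≤ treeCount` says that the tree's value exceeds `ρ - min ε ρ`. Probabilities below `ρ` are
  -- at most this number, and the others exceed it even after losing the error. The minimum with `ρ`
  -- keeps it nonnegative, as the natural floor requires.
  refine ⟨i * k, ⌊(ρ - min ε ρ) * 2 ^ (i * k)⌋₊ + 1, fun n φ hφ => ?_⟩
  have hnn : 0 ≤ (ρ - min ε ρ) * 2 ^ (i * k) :=
    mul_nonneg (sub_nonneg.2 (min_le_right _ _)) (by positivity)
  rw [Nat.add_one_le_iff, Nat.floor_lt hnn, ← lt_div_iff₀ (by positivity),
    ← le_div_iff₀ (by positivity)]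
  have h1 := treeError_nonneg φ (i * k) fun _ => none
  have h2 := treeError_le_pow hφ i (i * k) le_rfl fun _ => none
  rw [treeError, prob_none] at h1 h2
  constructor
  · intro h
    linarith
  · intro h
    by_contra! hlt
    have := hgap n φ hφ hlt
    have := min_le_left ε ρ
    linarith

/-! ### Reasoning about programs -/

/-- Started in `s`, the program halts within `T` steps in a state that satisfies `Q`. -/
def Runs (B : ℕ) (x : List ℕ) (p : Program) (s : State) (T : ℕ) (Q : State → Prop) : Prop :=
  ∃ t s', t ≤ T ∧ Exec B x p s t s' ∧ Q s'

/-- The program does not write to the register `r`. -/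
def Program.Keeps (r : ℕ) : Program → Prop
  | .skip => True
  | .const r' _ => r ≠ r'
  | .add r' _ _ => r ≠ r'
  | .sub r' _ _ => r ≠ r'
  | .load r' _ => r ≠ r'
  | .store _ _ => True
  | .read r' _ => r ≠ r'
  | .seq p q => p.Keeps r ∧ q.Keeps r
  | .branch _ p q => p.Keeps r ∧ q.Keeps r
  | .loop _ p => p.Keeps r

/-- The weakest precondition of a program without loops. -/
def wp (B : ℕ) (x : List ℕ) : Program → (State → Prop) → State → Prop
  | .skip, Q, s => Q s
  | .const r c, Q, s => c ≤ B ∧ Q (s.setReg r c)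
  | .add r a b, Q, s => s.reg a + s.reg b ≤ B ∧ Q (s.setReg r (s.reg a + s.reg b))
  | .sub r a b, Q, s => Q (s.setReg r (s.reg a - s.reg b))
  | .load r a, Q, s => Q (s.setReg r (s.mem (s.reg a)))
  | .store a b, Q, s => Q (s.setMem (s.reg a) (s.reg b))
  | .read r a, Q, s => x.getD (s.reg a) 0 ≤ B ∧ Q (s.setReg r (x.getD (s.reg a) 0))
  | .seq p q, Q, s => wp B x p (fun s' => wp B x q Q s') s
  | .branch a p q, Q, s => (s.reg a ≠ 0 → wp B x p Q s) ∧ (s.reg a = 0 → wp B x q Q s)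
  | .loop _ _, _, _ => False

/-- A bound on the running time of a program without loops. -/
def cost : Program → ℕ
  | .seq p q => cost p + cost q
  | .branch _ p q => cost p + cost q + 1
  | _ => 1

/-- Programs one after the other. -/
def block : List Program → Program
  | [] => .skip
  | [p] => p
  | p :: q :: ps => .seq p (block (q :: ps))

section Rules

variable {B : ℕ} {x : List ℕ} {p q : Program} {s : State} {T U a : ℕ} {Q R : State → Prop}

theorem Exec.keeps {r t : ℕ} {s' : State} (h : Exec B x p s t s') (hp : p.Keeps r) :
    s'.reg r = s.reg r := by
  induction h with
  | skip | store => rfl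
  | const | add | sub | load | read => exact Function.update_of_ne hp _ _
  | seq _ _ _ _ _ _ _ _ _ ih1 ih2 => rw [ih2 hp.2, ih1 hp.1]
  | branch_nonzero _ _ _ _ _ _ _ _ ih => exact ih hp.1
  | branch_zero _ _ _ _ _ _ _ _ ih => exact ih hp.2
  | loop_zero => rfl
  | loop_nonzero _ _ _ _ _ _ _ _ _ _ ih1 ih2 => rw [ih2 hp, ih1 hp]

theorem Runs.keeps (h : Runs B x p s T Q) :
    Runs B x p s T fun s' => Q s' ∧ ∀ r, p.Keeps r → s'.reg r = s.reg r := by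
  obtain ⟨t, s', ht, he, hQ⟩ := h
  exact ⟨t, s', ht, he, hQ, fun r hr => he.keeps hr⟩

theorem Runs.mono (h : Runs B x p s T Q) (hT : T ≤ U) (hQ : ∀ s', Q s' → R s') :
    Runs B x p s U R := by
  obtain ⟨t, s', ht, he, h⟩ := h
  exact ⟨t, s', ht.trans hT, he, hQ s' h⟩

theorem Runs.seq (h : Runs B x p s T fun s' => Runs B x q s' U Q) :
    Runs B x (.seq p q) s (T + U) Q := by
  obtain ⟨t, s', ht, he, u, s'', hu, he', hQ⟩ := h
  exact ⟨t + u, s'', add_le_add ht hu, .seq _ _ _ _ _ _ _ he he', hQ⟩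

theorem Runs.branch (h1 : s.reg a ≠ 0 → Runs B x p s T Q) (h2 : s.reg a = 0 → Runs B x q s T Q) :
    Runs B x (.branch a p q) s (T + 1) Q := by
  by_cases h : s.reg a = 0
  · obtain ⟨t, s', ht, he, hQ⟩ := h2 h
    exact ⟨t + 1, s', by omega, .branch_zero _ _ _ _ _ _ h he, hQ⟩
  · obtain ⟨t, s', ht, he, hQ⟩ := h1 h
    exact ⟨t + 1, s', by omega, .branch_nonzero _ _ _ _ _ _ h he, hQ⟩

theorem Runs.loop_zero (h : s.reg a = 0) (hQ : Q s) : Runs B x (.loop a p) s 1 Q :=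
  ⟨1, s, le_rfl, .loop_zero _ _ _ h, hQ⟩

theorem Runs.loop_nonzero (h : s.reg a ≠ 0)
    (hp : Runs B x p s T fun s' => Runs B x (.loop a p) s' U Q) :
    Runs B x (.loop a p) s (T + U + 1) Q := by
  obtain ⟨t, s', ht, he, u, s'', hu, he', hQ⟩ := hp
  exact ⟨t + u + 1, s'', by omega, .loop_nonzero _ _ _ _ _ _ _ h he he', hQ⟩

theorem runs_of_wp (p : Program) : ∀ {s : State} {Q : State → Prop}, wp B x p Q s →
    Runs B x p s (cost p) Q := by
  induction p with
  | skip => exact fun h => ⟨1, _, le_rfl, .skip _, h⟩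
  | const r c => exact fun h => ⟨1, _, le_rfl, .const _ _ _ h.1, h.2⟩
  | add r a b => exact fun h => ⟨1, _, le_rfl, .add _ _ _ _ h.1, h.2⟩
  | sub r a b => exact fun h => ⟨1, _, le_rfl, .sub _ _ _ _, h⟩
  | load r a => exact fun h => ⟨1, _, le_rfl, .load _ _ _, h⟩
  | store a b => exact fun h => ⟨1, _, le_rfl, .store _ _ _, h⟩
  | read r a => exact fun h => ⟨1, _, le_rfl, .read _ _ _ h.1, h.2⟩
  | seq p q ih1 ih2 => exact fun h => ((ih1 h).mono le_rfl fun _ h' => ih2 h').seq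
  | branch a p q ih1 ih2 =>
    exact fun h => Runs.branch (fun h0 => (ih1 (h.1 h0)).mono (Nat.le_add_right _ _) fun _ => id)
      fun h0 => (ih2 (h.2 h0)).mono (Nat.le_add_left _ _) fun _ => id
  | loop => exact fun h => h.elim

theorem reg_setReg (s : State) (r v r' : ℕ) :
    (s.setReg r v).reg r' = if r' = r then v else s.reg r' :=
  Function.update_apply _ _ _ _

theorem mem_setReg (s : State) (r v : ℕ) : (s.setReg r v).mem = s.mem := rfl

theorem reg_setMem (s : State) (a v : ℕ) : (s.setMem a v).reg = s.reg := rfl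

theorem mem_setMem (s : State) (a v : ℕ) : (s.setMem a v).mem = Function.update s.mem a v := rfl

end Rules

/-! ### The program -/

/-- `r7 := r7 + 1` if the registers `a` and `b` are equal. -/
def countEq (a b : ℕ) : Program :=
  block [.sub 14 a b, .sub 15 b a, .add 14 14 15, .sub 14 1 14, .add 7 7 14]

/-- Reads a literal at the input position `r3`. Increases `r7` if it is true or complementary to
one of the previous two literals, whose codes are in `r9` and `r10`; stores the successor of
its variable in `r8` if that is free. -/
def literalProgram : Program :=
  block [.read 11 3, .add 3 3 1, .read 12 3, .add 3 3 1, .load 13 11,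
    .add 16 12 1, countEq 13 16,
    .add 16 11 11, .add 16 16 2, .sub 16 16 12, countEq 9 16, countEq 10 16,
    .add 10 9 17, .add 9 11 11, .add 9 9 12, .add 9 9 1,
    .sub 6 6 1, .branch 13 .skip (.add 8 11 1)]

/-- Reads a clause at the input position `r3`. If it is unsettled, sets `r5` to `1` and the number
`r4` of clauses that remain to `0`. -/
def clauseProgram : Program :=
  .seq (block [.read 6 3, .add 3 3 1, .const 7 0, .const 8 0, .const 9 0, .const 10 0])
    (.seq (.loop 6 literalProgram)
      (.branch 7 (.sub 4 4 1) (block [.const 4 0, .const 5 1])))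

/-- Looks for the first unsettled clause. -/
def scanProgram : Program :=
  .seq (block [.const 1 1, .const 2 2, .const 17 0, .const 3 2, .read 4 1, .const 5 0])
    (.loop 4 clauseProgram)

/-- Adds the weight of the satisfied leaves of the decision tree of depth `d` to `r0`. -/
def treeProgram : ℕ → Program
  | 0 => .seq scanProgram (.branch 5 .skip (.add 0 0 1))
  | d + 1 => .seq scanProgram (.branch 5
      (.branch 8
        (.seq (block [.sub (18 + d) 8 1, .store (18 + d) 2])
          (.seq (treeProgram d)
            (.seq (block [.const 1 1, .store (18 + d) 1])
              (.seq (treeProgram d)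
                (block [.const 1 0, .store (18 + d) 1])))))
        .skip)
      (block [.const 4 (2 ^ (d + 1)), .add 0 0 4]))

/-- Compares the weight of the satisfied leaves of the decision tree with `N`. -/
def thresholdProgram (d N : ℕ) : Program :=
  .seq (treeProgram d)
    (block [.const 1 N, .sub 1 1 0, .branch 1 (.const 0 0) (.const 0 1)])

/-! ### Correctness and running time of the program -/

section Correctness

variable {n : ℕ}

/-- The memory cell of a variable. -/
def cell : Option Bool → ℕ
  | none => 0
  | some b => b.toNat + 1

/-- The registers `r7`, `r8`, `r9`, `r10` while a clause is read. -/
structure ClauseState where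
  sat : ℕ
  free : ℕ
  prev : ℕ
  prev' : ℕ

/-- The code of a literal. -/
def code (l : Literal n) : ℕ := 2 * l.1 + l.2.toNat + 1

/-- The code of the complementary literal. -/
def cocode (l : Literal n) : ℕ := 2 * l.1 + 2 - l.2.toNat

/-- The effect of `literalProgram` on the registers `r7`, `r8`, `r9`, `r10`. -/
def literalStep (α : PAssign n) (c : ClauseState) (l : Literal n) : ClauseState where
  sat := c.sat + (if cell (α l.1) = l.2.toNat + 1 then 1 else 0) +
    (if c.prev = cocode l then 1 else 0) + (if c.prev' = cocode l then 1 else 0)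
  free := if α l.1 = none then l.1 + 1 else c.free
  prev := code l
  prev' := c.prev

/-- The registers while a clause is read. -/
structure ClauseRegs (s : State) (pos w cnt : ℕ) (c : ClauseState) : Prop where
  one : s.reg 1 = 1
  two : s.reg 2 = 2
  pos : s.reg 3 = pos
  cnt : s.reg 4 = cnt
  res : s.reg 5 = 0
  width : s.reg 6 = w
  sat : s.reg 7 = c.sat
  free : s.reg 8 = c.free
  prev : s.reg 9 = c.prev
  prev' : s.reg 10 = c.prev'
  zero : s.reg 17 = 0

/-- The memory represents the partial assignment `α`. -/
def MemRep (s : State) (α : PAssign n) : Prop := ∀ v : Fin n, s.mem v = cell (α v)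

theorem getD_of_drop {x : List ℕ} {pos a : ℕ} {t : List ℕ} (h : x.drop pos = a :: t) :
    pos < x.length ∧ x.getD pos 0 = a ∧ x.drop (pos + 1) = t := by
  have hlt : pos < x.length := by
    by_contra hge
    rw [List.drop_eq_nil_of_le (not_lt.1 hge)] at h
    cases h
  rw [List.drop_eq_getElem_cons hlt] at h
  injection h with h1 h2
  exact ⟨hlt, by simp [List.getD, hlt, h1], h2⟩

theorem one_sub_dist (a b : ℕ) : 1 - (a - b + (b - a)) = if a = b then 1 else 0 := by
  split <;> omega

theorem runs_literalProgram {B : ℕ} {x : List ℕ} {α : PAssign n} {s : State} {pos w cnt : ℕ}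
    {c : ClauseState} {l : Literal n} {rest : List ℕ} (hs : ClauseRegs s pos (w + 1) cnt c)
    (hm : MemRep s α) (hx : x.drop pos = l.1.val :: l.2.toNat :: rest)
    (hB : 2 * n + 2 ≤ B) (hB' : x.length + 1 ≤ B) (hsat : c.sat + 3 ≤ B)
    (hprev : c.prev ≤ 2 * n) (hprev' : c.prev' ≤ 2 * n) :
    Runs B x literalProgram s (cost literalProgram) fun s' =>
      ClauseRegs s' (pos + 2) w cnt (literalStep α c l) ∧ s'.mem = s.mem := by
  obtain ⟨h1, g1, hx⟩ := getD_of_drop hx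
  obtain ⟨h2, g2, -⟩ := getD_of_drop hx
  obtain ⟨e1, e2, e3, e4, e5, e6, e7, e8, e9, e10, e17⟩ := hs
  have hv := l.1.isLt
  have hb : l.2.toNat ≤ 1 := Bool.toNat_le _
  have hc : cell (α l.1) ≤ 2 := by
    cases α l.1 with
    | none => simp [cell]
    | some b => have := Bool.toNat_le b; simp only [cell]; omega
  have hcn : cell (α l.1) = 0 ↔ α l.1 = none := by cases α l.1 <;> simp [cell]
  apply runs_of_wp
  simp only [literalProgram, countEq, block, wp, reg_setReg, mem_setReg, e1, e2, e3, e6,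
    e7, e9, e10, e17, g1, g2, hm l.1, reduceIte, Nat.reduceEqDiff, OfNat.one_ne_ofNat, one_sub_dist]
  have ite_le : ∀ (p : Prop) [Decidable p], (if p then 1 else 0) ≤ 1 := by
    intro p _; split <;> simp
  have i1 := ite_le (cell (α l.1) = l.2.toNat + 1)
  have i2 := ite_le (c.prev = l.1.val + l.1.val + 2 - l.2.toNat)
  have i3 := ite_le (c.prev' = l.1.val + l.1.val + 2 - l.2.toNat)
  refine ⟨by omega, by omega, by omega, by omega, by omega, by omega, by omega, by omega, by omega,
    by omega, by omega, by omega, by omega, by omega, by omega, by omega, by omega, ?_⟩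
  constructor <;> intro h0
  on_goal 2 => refine ⟨by omega, ?_⟩
  all_goals
    refine ⟨?_, trivial⟩
    simp only [ne_eq, hcn] at h0
    constructor <;>
    simp [reg_setReg, e1, e2, e4, e5, e8, e17, literalStep, code, cocode, two_mul, h0]

theorem runs_literals {B : ℕ} {x : List ℕ} {α : PAssign n} (hB : 2 * n + 2 ≤ B)
    (hB' : x.length + 1 ≤ B) {cnt : ℕ} {rest : List ℕ} (ls : Clause n) :
    ∀ {s : State} {pos : ℕ} {c : ClauseState}, ClauseRegs s pos ls.length cnt c → MemRep s α →
      x.drop pos = ls.flatMap encodeLiteral ++ rest → c.sat + 3 * ls.length ≤ B →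
      c.prev ≤ 2 * n → c.prev' ≤ 2 * n →
      Runs B x (.loop 6 literalProgram) s ((cost literalProgram + 1) * ls.length + 1) fun s' =>
        ClauseRegs s' (pos + 2 * ls.length) 0 cnt (ls.foldl (literalStep α) c) ∧ s'.mem = s.mem ∧
          x.drop (pos + 2 * ls.length) = rest := by
  induction ls with
  | nil =>
    intro s pos c hs hm hx _ _ _
    exact Runs.loop_zero hs.width ⟨hs, rfl, hx⟩
  | cons l ls ih =>
    intro s pos c hs hm hx hsat hprev hprev'
    have hx' : x.drop pos = l.1.val :: l.2.toNat :: (ls.flatMap encodeLiteral ++ rest) := by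
      simpa [encodeLiteral] using hx
    have hdrop := (getD_of_drop (getD_of_drop hx').2.2).2.2
    have hv := l.1.isLt
    have hb : l.2.toNat ≤ 1 := Bool.toNat_le _
    rw [List.length_cons] at hs hsat
    have ite_le : ∀ (p : Prop) [Decidable p], (if p then 1 else 0) ≤ 1 := by
      intro p _; split <;> simp
    have i1 := ite_le (cell (α l.1) = l.2.toNat + 1)
    have i2 := ite_le (c.prev = cocode l)
    have i3 := ite_le (c.prev' = cocode l)
    refine (Runs.loop_nonzero (U := (cost literalProgram + 1) * ls.length + 1)
      (by rw [hs.width]; omega)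
      ((runs_literalProgram hs hm hx' hB hB' (by omega) hprev hprev').mono le_rfl ?_)).mono
      (by rw [List.length_cons, Nat.mul_succ]; omega) fun _ => id
    rintro s' ⟨hs', hm'⟩
    refine (ih hs' (by unfold MemRep; rwa [hm']) (by simpa [add_assoc] using hdrop)
      (by simp only [literalStep]; omega) (by simp only [literalStep, code]; omega) hprev).mono
      le_rfl ?_
    rintro s'' ⟨h1, h2, h3⟩
    rw [List.length_cons, Nat.mul_succ, add_comm (2 * _) 2, ← add_assoc]
    exact ⟨h1, h2.trans hm', h3⟩

theorem code_eq_cocode (l l' : Literal n) : code l = cocode l' ↔ l = (l'.1, !l'.2) := by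
  obtain ⟨v, b⟩ := l
  obtain ⟨v', b'⟩ := l'
  simp only [code, cocode, Prod.mk.injEq, Fin.ext_iff]
  cases b <;> cases b' <;> simp <;> omega

/-- Codes start at `1`, so a `0` in `r9` or `r10`, meaning that there is no such previous literal,
never matches. -/
theorem cocode_pos (l : Literal n) : 0 ≠ cocode l := by
  have : l.2.toNat ≤ 1 := Bool.toNat_le _
  unfold cocode; omega

theorem cell_eq (o : Option Bool) (b : Bool) : cell o = b.toNat + 1 ↔ o = some b := by
  cases o with
  | none => simp [cell]
  | some b' => cases b <;> cases b' <;> simp [cell]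

/-- In a clause of width at most three, all earlier literals are among the previous two. Hence
comparing with `r9` and `r10` detects every complementary pair. -/
theorem foldl_sat_eq_zero (α : PAssign n) (c : Clause n) (hc : c.length ≤ 3) :
    (c.foldl (literalStep α) ⟨0, 0, 0, 0⟩).sat = 0 ↔ ¬ Settled α c := by
  have hs : ∀ a b : Literal n, (a.1, !a.2) = b ↔ a = (b.1, !b.2) := by
    rintro ⟨a, x⟩ ⟨b, y⟩
    cases x <;> cases y <;> simp
  have hself : ∀ a : Literal n, ¬ a = (a.1, !a.2) := fun a h => by
    simpa using congrArg Prod.snd h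
  have hsymm : ∀ a b : Literal n, a = (b.1, !b.2) ↔ b = (a.1, !a.2) := fun a b => by
    rw [← hs, eq_comm]
  rcases c with _ | ⟨l₁, _ | ⟨l₂, _ | ⟨l₃, _ | ⟨l₄, c⟩⟩⟩⟩
  · simp [Settled]
  · simp [Settled, literalStep, cell_eq, cocode_pos, hs, hself]
  · simp [Settled, literalStep, cell_eq, cocode_pos, hs, hself, code_eq_cocode]
    have := hsymm l₁ l₂
    tauto
  · simp [Settled, literalStep, cell_eq, cocode_pos, hs, hself, code_eq_cocode]
    have h1 := hsymm l₁ l₂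
    have h2 := hsymm l₁ l₃
    have h3 := hsymm l₂ l₃
    tauto
  · simp only [List.length_cons] at hc
    omega

theorem foldl_free (α : PAssign n) (c : Clause n) : ∀ (r : ClauseState) (u : Option (Fin n)),
    r.free = u.elim 0 (fun v => v.val + 1) →
    (c.foldl (literalStep α) r).free = (lastFree α u c).elim 0 (fun v => v.val + 1) := by
  induction c with
  | nil => exact fun r u h => h
  | cons l c ih =>
    intro r u h
    refine ih _ _ ?_
    by_cases hf : α l.1 = none
    · simp [literalStep, hf]
    · simp [literalStep, hf, h]

/-- The registers between two clauses. -/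
structure ScanRegs (s : State) (pos cnt : ℕ) : Prop where
  one : s.reg 1 = 1
  two : s.reg 2 = 2
  zero : s.reg 17 = 0
  pos : s.reg 3 = pos
  cnt : s.reg 4 = cnt
  res : s.reg 5 = 0

/-- What a scan reports if it stops at an unsettled clause `c`. -/
structure Stopped (s : State) (α : PAssign n) (c : Clause n) : Prop where
  cnt : s.reg 4 = 0
  res : s.reg 5 = 1
  free : s.reg 8 = (lastFree α none c).elim 0 fun v => v.val + 1

theorem runs_clauseProgram {B : ℕ} {x : List ℕ} {α : PAssign n} {s : State} {pos cnt : ℕ}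
    {c : Clause n} {rest : List ℕ} (hs : ScanRegs s pos (cnt + 1)) (hm : MemRep s α)
    (hx : x.drop pos = encodeClause c ++ rest) (hc : c.length ≤ 3)
    (hB : 2 * n + 2 ≤ B) (hB' : x.length + 1 ≤ B) (hB9 : 9 ≤ B) :
    Runs B x clauseProgram s (33 * c.length + 11) fun s' => s'.mem = s.mem ∧
      (Settled α c → ScanRegs s' (pos + 1 + 2 * c.length) cnt ∧
        x.drop (pos + 1 + 2 * c.length) = rest) ∧
      (¬ Settled α c → Stopped s' α c) := by
  obtain ⟨h1, g1, hx⟩ := getD_of_drop hx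
  obtain ⟨e1, e2, e17, e3, e4, e5⟩ := hs
  have start : Runs B x (block [.read 6 3, .add 3 3 1, .const 7 0, .const 8 0, .const 9 0,
      .const 10 0]) s 6 fun s' =>
        ClauseRegs s' (pos + 1) c.length (cnt + 1) ⟨0, 0, 0, 0⟩ ∧ s'.mem = s.mem := by
    apply runs_of_wp (block [.read 6 3, .add 3 3 1, .const 7 0, .const 8 0, .const 9 0,
      .const 10 0])
    simp only [block, wp, reg_setReg, mem_setReg, e1, e3, g1, reduceIte, Nat.reduceEqDiff,
      OfNat.one_ne_ofNat]
    refine ⟨by omega, by omega, by omega, by omega, by omega, by omega, ?_, trivial⟩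
    constructor <;> simp [reg_setReg, e1, e2, e4, e5, e17]
  refine (Runs.seq (U := 33 * c.length + 5)
    (start.mono le_rfl fun s₁ ⟨hs₁, hm₁⟩ => ?_)).mono (by omega) fun _ => id
  refine (Runs.seq (U := 4) ((runs_literals (α := α) hB hB' c hs₁ (by unfold MemRep; rwa [hm₁]) hx
    (show 0 + 3 * c.length ≤ B by omega) (Nat.zero_le _) (Nat.zero_le _)).mono le_rfl
    fun s₂ ⟨hs₂, hm₂, hx₂⟩ => ?_)).mono
    (by simp only [cost, literalProgram, countEq, block]; omega) fun _ => id
  have hsat := foldl_sat_eq_zero α c hc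
  have hfree := foldl_free α c ⟨0, 0, 0, 0⟩ none rfl
  obtain ⟨f1, f2, f3, f4, f5, -, f7, f8, -, -, f17⟩ := hs₂
  rw [← f7] at hsat
  rw [← f8] at hfree
  apply runs_of_wp (.branch 7 (.sub 4 4 1) (block [.const 4 0, .const 5 1]))
  simp only [block, wp, mem_setReg, f1, f4]
  refine ⟨fun h7 => ⟨by rw [hm₂, hm₁], fun _ => ⟨?_, hx₂⟩, fun h => absurd (hsat.2 h) h7⟩,
    fun h7 => ⟨by omega, by omega, by rw [hm₂, hm₁], fun h => absurd h (hsat.1 h7), fun _ => ?_⟩⟩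
  · constructor <;> simp [reg_setReg, f1, f2, f3, f5, f17]
  · constructor <;> simp [reg_setReg, hfree]

theorem runs_clauses {B : ℕ} {x : List ℕ} {α : PAssign n} (hB : 2 * n + 2 ≤ B)
    (hB' : x.length + 1 ≤ B) (hB9 : 9 ≤ B) (φ : CNF n) :
    ∀ {s : State} {pos : ℕ}, ScanRegs s pos φ.length → MemRep s α → IsKCNF 3 φ →
      x.drop pos = φ.flatMap encodeClause →
      Runs B x (.loop 4 clauseProgram) s (45 * (size φ + 1)) fun s' => s'.mem = s.mem ∧
        s'.reg 1 = 1 ∧ s'.reg 2 = 2 ∧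
        match φ.find? fun c => ¬ Settled α c with
        | none => s'.reg 5 = 0
        | some c => s'.reg 5 = 1 ∧ s'.reg 8 = (lastFree α none c).elim 0 fun v => v.val + 1 := by
  have keeps : clauseProgram.Keeps 1 ∧ clauseProgram.Keeps 2 := by
    simp [clauseProgram, Program.Keeps, literalProgram, countEq, block]
  induction φ with
  | nil =>
    intro s pos hs _ _ _
    exact (Runs.loop_zero hs.cnt ⟨rfl, hs.one, hs.two, hs.res⟩).mono (by omega) fun _ => id
  | cons c φ ih =>
    intro s pos hs hm hφ hx
    have hsize : size (c :: φ) = c.length + size φ := by simp [size]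
    rw [List.length_cons] at hs
    rw [List.flatMap_cons] at hx
    have run := (runs_clauseProgram hs hm hx (hφ c (by simp)) hB hB' hB9).keeps
    have h4 : s.reg 4 ≠ 0 := by rw [hs.cnt]; omega
    by_cases hc : Settled α c
    -- The empty clause is unsettled and ends the scan. Every clause passed thus has positive width,
    -- which absorbs the constant cost per clause: `33 * w + 12 ≤ 45 * w` for `w ≥ 1`.
    · have hlen : 1 ≤ c.length := by
        rcases c with _ | ⟨l, c⟩
        · simp [Settled] at hc
        · simp
      refine (Runs.loop_nonzero (U := 45 * (size φ + 1)) h4 (run.mono le_rfl ?_)).mono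
        (by rw [hsize]; omega) fun _ => id
      rintro s' ⟨⟨hm', hset, -⟩, -⟩
      obtain ⟨hs', hx'⟩ := hset hc
      refine (ih hs' (by unfold MemRep; rwa [hm']) (fun d hd => hφ d (by simp [hd])) hx').mono
        le_rfl ?_
      rintro s'' ⟨h1, h2⟩
      rw [List.find?_cons_of_neg (by simpa using hc)]
      exact ⟨h1.trans hm', h2⟩
    · refine (Runs.loop_nonzero (U := 1) h4 (run.mono le_rfl ?_)).mono
        (by rw [hsize]; omega) fun _ => id
      rintro s' ⟨⟨hm', -, hunset⟩, hk⟩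
      obtain ⟨h4', h5', h8'⟩ := hunset hc
      refine Runs.loop_zero h4' ?_
      rw [List.find?_cons_of_pos (by simpa using hc)]
      exact ⟨hm', (hk 1 keeps.1).trans hs.one, (hk 2 keeps.2).trans hs.two, h5', h8'⟩

theorem runs_scanProgram {B : ℕ} {φ : CNF n} {α : PAssign n} {s : State} (hφ : IsKCNF 3 φ)
    (hm : MemRep s α) (hB : 2 * n + 2 ≤ B) (hB' : (encode φ).length + 1 ≤ B) (hB9 : 9 ≤ B) :
    Runs B (encode φ) scanProgram s (51 * (size φ + 1)) fun s' => s'.mem = s.mem ∧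
      s'.reg 0 = s.reg 0 ∧ (∀ r ≥ 18, s'.reg r = s.reg r) ∧ s'.reg 1 = 1 ∧ s'.reg 2 = 2 ∧
        match φ.find? fun c => ¬ Settled α c with
        | none => s'.reg 5 = 0
        | some c => s'.reg 5 = 1 ∧ s'.reg 8 = (lastFree α none c).elim 0 fun v => v.val + 1 := by
  have keeps : ∀ r, r = 0 ∨ 18 ≤ r → scanProgram.Keeps r := by
    intro r hr
    simp only [scanProgram, clauseProgram, Program.Keeps, literalProgram, countEq, block,
      true_and]
    omega
  have hlen : φ.length ≤ (encode φ).length := by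
    have : φ.length ≤ (φ.flatMap encodeClause).length := by
      rw [List.length_flatMap]
      simpa using List.length_le_sum_of_one_le (φ.map fun c => (encodeClause c).length)
        (by simp [encodeClause])
    simp only [encode, List.length_cons]
    omega
  have start : Runs B (encode φ) (block [.const 1 1, .const 2 2, .const 17 0, .const 3 2,
      .read 4 1, .const 5 0]) s 6 fun s' => ScanRegs s' 2 φ.length ∧ s'.mem = s.mem := by
    apply runs_of_wp (block [.const 1 1, .const 2 2, .const 17 0, .const 3 2, .read 4 1,
      .const 5 0])
    have g : (encode φ).getD 1 0 = φ.length := rfl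
    simp only [block, wp, reg_setReg, mem_setReg, g, reduceIte, OfNat.one_ne_ofNat]
    refine ⟨by omega, by omega, by omega, by omega, by omega, by omega, ?_, trivial⟩
    constructor <;> simp [reg_setReg]
  have run := Runs.seq (start.mono le_rfl fun s₁ ⟨hs₁, hm₁⟩ =>
    (runs_clauses hB hB' hB9 φ hs₁ (α := α) (by unfold MemRep; rwa [hm₁]) hφ rfl).mono le_rfl
      fun s' h => And.intro (h.1.trans hm₁) h.2)
  exact run.keeps.mono (by omega) fun s' ⟨⟨hm', h⟩, hk⟩ =>
    ⟨hm', hk 0 (keeps 0 (.inl rfl)), fun r hr => hk r (keeps r (.inr hr)), h⟩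

/-- A bound on the running time of `treeProgram d`, in units of the size of the formula. -/
def treeTime : ℕ → ℕ
  | 0 => 54
  | d + 1 => 2 * treeTime d + 66

theorem MemRep.store {s s' : State} {α : PAssign n} (hm : MemRep s α) (v : Fin n) (o : Option Bool)
    (h : s'.mem = Function.update s.mem v (cell o)) : MemRep s' (Function.update α v o) := by
  intro w
  rw [h]
  by_cases e : w = v
  · subst e; simp
  · rw [Function.update_of_ne (fun h => e (Fin.ext h)), Function.update_of_ne e, hm w]

/-- Level `d + 1` keeps its branching variable in register `18 + d`, which the calls at level `d`
preserve. Each call restores the memory to `α`, so both subtrees start from the right partial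
assignment. -/
theorem runs_treeProgram {B : ℕ} {φ : CNF n} (hφ : IsKCNF 3 φ)
    (hB : 2 * n + 2 ≤ B) (hB' : (encode φ).length + 1 ≤ B) (hB9 : 9 ≤ B) (d : ℕ) :
    ∀ {α : PAssign n} {s : State}, MemRep s α → s.reg 0 + 2 ^ d ≤ B →
      Runs B (encode φ) (treeProgram d) s (treeTime d * (size φ + 1)) fun s' =>
        s'.reg 0 = s.reg 0 + treeCount φ d α ∧ MemRep s' α ∧
          ∀ r ≥ 18 + d, s'.reg r = s.reg r := by
  induction d with
  | zero =>
    intro α s hm h0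
    refine (Runs.seq (U := 3) ((runs_scanProgram hφ hm hB hB' hB9).mono le_rfl ?_)).mono
      (by unfold treeTime; omega) fun _ => id
    rintro s₁ ⟨hm₁, z₁, k₁, o₁, t₁, hfind⟩
    apply runs_of_wp (.branch 5 .skip (.add 0 0 1))
    have hm' : MemRep s₁ α := by unfold MemRep; rwa [hm₁]
    rcases h : φ.find? (fun c => ¬ Settled α c) with _ | c
    · rw [h] at hfind
      simp only [wp, hfind, z₁, o₁]
      refine ⟨fun h => absurd rfl h, fun _ => ⟨h0, ?_, hm', fun r hr => ?_⟩⟩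
      · simp [reg_setReg, treeCount_of_none h]
      · rw [reg_setReg, if_neg (by omega), k₁ r hr]
    · rw [h] at hfind
      simp only [wp, hfind.1, z₁]
      refine ⟨fun _ => ⟨?_, hm', k₁⟩, fun h => absurd h one_ne_zero⟩
      simp only [treeCount, h, add_zero]
  | succ d ih =>
    intro α s hm h0
    refine (Runs.seq (U := 2 * (treeTime d * (size φ + 1)) + 15)
      ((runs_scanProgram hφ hm hB hB' hB9).mono le_rfl ?_)).mono
      (by simp only [treeTime]; nlinarith) fun _ => id
    rintro s₁ ⟨hm₁, z₁, k₁, o₁, t₁, hfind⟩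
    have hm' : MemRep s₁ α := by unfold MemRep; rwa [hm₁]
    rcases h : φ.find? (fun c => ¬ Settled α c) with _ | c
    · rw [h] at hfind
      refine (Runs.branch (T := 2) (fun h => absurd hfind h) fun _ => ?_).mono (by omega)
        fun _ => id
      apply runs_of_wp (block [.const 4 (2 ^ (d + 1)), .add 0 0 4])
      simp only [block, wp, reg_setReg, reduceIte, OfNat.zero_ne_ofNat, z₁]
      refine ⟨by omega, h0, ?_, hm', fun r hr => ?_⟩
      · simp [treeCount_of_none h]
      · rw [if_neg (by omega), if_neg (by omega), k₁ r (by omega)]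
    · rw [h] at hfind
      replace hfind : s₁.reg 5 = 1 ∧
        s₁.reg 8 = (lastFree α none c).elim 0 fun v => v.val + 1 := hfind
      refine (Runs.branch (T := 2 * (treeTime d * (size φ + 1)) + 14) (fun _ => ?_)
        fun h => absurd (hfind.1.symm.trans h) one_ne_zero).mono (by omega) fun _ => id
      rcases hc : lastFree α none c with _ | v
      · rw [hc] at hfind
        refine (Runs.branch (T := 1) (fun h => absurd hfind.2 h) fun _ => ?_).mono (by omega)
          fun _ => id
        refine runs_of_wp .skip ⟨?_, hm', fun r hr => k₁ r (by omega)⟩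
        rw [treeCount_of_lastFree_none h hc, z₁, add_zero]
      · rw [hc] at hfind
        have h8 : s₁.reg 8 = v.val + 1 := hfind.2
        have hv : α v = none := by
          rcases lastFree_eq_some α c v none hc with h | ⟨_, _, _, h⟩
          · cases h
          · exact h
        rw [treeCount_succ h hc]
        -- The first subtree adds at most `2 ^ d` to `r0`, which leaves room for the second one in a
        -- word.
        have hle := treeCount_le φ d (assign α v true)
        refine (Runs.branch (T := 2 * (treeTime d * (size φ + 1)) + 6) (fun _ => ?_)
          fun h => by omega).mono (by omega) fun _ => id
        have first : Runs B (encode φ) (block [.sub (18 + d) 8 1, .store (18 + d) 2]) s₁ 2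
            fun s₂ => MemRep s₂ (assign α v true) ∧ s₂.reg 0 = s.reg 0 ∧
              s₂.reg (18 + d) = v ∧ ∀ r ≥ 18 + (d + 1), s₂.reg r = s.reg r := by
          apply runs_of_wp (block [.sub (18 + d) 8 1, .store (18 + d) 2])
          simp only [block, wp, reg_setReg, h8, o₁, reg_setMem, if_true]
          rw [if_neg (by omega), if_neg (by omega), t₁]
          refine ⟨hm'.store v (some true) (by simp [mem_setMem, mem_setReg, cell]), z₁, by simp,
            fun r hr => ?_⟩
          rw [if_neg (by omega), k₁ r (by omega)]
        refine (Runs.seq (U := 2 * (treeTime d * (size φ + 1)) + 4)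
          (first.mono le_rfl ?_)).mono (by omega) fun _ => id
        rintro s₂ ⟨m₂, z₂, v₂, k₂⟩
        refine (Runs.seq (U := treeTime d * (size φ + 1) + 4)
          ((ih m₂ (by omega)).mono le_rfl ?_)).mono (by omega) fun _ => id
        rintro s₃ ⟨z₃, m₃, k₃⟩
        have update : ∀ (b : ℕ) (o : Option Bool) (s₃ : State) (z : ℕ) (β : PAssign n),
            b = cell o → b ≤ B → s₃.reg 0 = z → MemRep s₃ β → s₃.reg (18 + d) = v →
            (∀ r ≥ 18 + (d + 1), s₃.reg r = s.reg r) →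
            Runs B (encode φ) (block [.const 1 b, .store (18 + d) 1]) s₃ 2 fun s₄ =>
              MemRep s₄ (Function.update β v o) ∧ s₄.reg 0 = z ∧ s₄.reg (18 + d) = v ∧
                ∀ r ≥ 18 + (d + 1), s₄.reg r = s.reg r := by
          intro b o s₃ z β hb hbB hz hβ hv hk
          apply runs_of_wp (block [.const 1 b, .store (18 + d) 1])
          simp only [block, wp, reg_setReg, reg_setMem, if_true, zero_ne_one, if_false]
          rw [if_neg (by omega), hv]
          refine ⟨hbB, hβ.store v o (by simp [mem_setMem, mem_setReg, hb]), hz, rfl,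
            fun r hr => ?_⟩
          rw [if_neg (by omega), hk r hr]
        refine (Runs.seq (U := treeTime d * (size φ + 1) + 2)
          ((update 1 (some false) s₃ _ _ rfl (by omega) z₃ m₃ ((k₃ _ le_rfl).trans v₂)
            fun r hr => (k₃ r (by omega)).trans (k₂ r hr)).mono le_rfl ?_)).mono
          (by omega) fun _ => id
        rintro s₄ ⟨m₄, z₄, v₄, k₄⟩
        have e₄ : Function.update (assign α v true) v (some false) = assign α v false := by
          simp [assign]
        rw [e₄] at m₄
        have hle' := treeCount_le φ d (assign α v false)
        refine Runs.seq (U := 2) ((ih m₄ (by omega)).mono le_rfl ?_)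
        rintro s₅ ⟨z₅, m₅, k₅⟩
        refine (update 0 none s₅ _ _ rfl (by omega) z₅ m₅ ((k₅ _ le_rfl).trans v₄)
          fun r hr => (k₅ r (by omega)).trans (k₄ r hr)).mono le_rfl ?_
        rintro s₆ ⟨m₆, z₆, -, k₆⟩
        have e₆ : Function.update (assign α v false) v none = α := by
          rw [assign, Function.update_idem, ← hv, Function.update_eq_self]
        rw [e₆] at m₆
        exact ⟨by omega, m₆, k₆⟩

theorem answers_thresholdProgram {B : ℕ} {φ : CNF n} (hφ : IsKCNF 3 φ)
    (hB : 2 * n + 2 ≤ B) (hB' : (encode φ).length + 1 ≤ B) (hB9 : 9 ≤ B) {d N : ℕ}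
    (hd : 2 ^ d ≤ B) (hN : N ≤ B) :
    (thresholdProgram d N).Answers B (encode φ) ((treeTime d + 5) * (size φ + 1))
      (N ≤ treeCount φ d fun _ => none) := by
  suffices h : Runs B (encode φ) (thresholdProgram d N) State.init
      ((treeTime d + 5) * (size φ + 1)) fun s => (N ≤ treeCount φ d (fun _ => none) → s.reg 0 = 1) ∧
        (¬ N ≤ treeCount φ d (fun _ => none) → s.reg 0 = 0) from h
  have hm : MemRep State.init (fun _ : Fin n => none) := fun _ => rfl
  refine (Runs.seq (U := 5) ((runs_treeProgram hφ hB hB' hB9 d hm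
    (by simpa [State.init] using hd)).mono le_rfl ?_)).mono (by nlinarith) fun _ => id
  rintro s ⟨z, -, -⟩
  have z' : s.reg 0 = treeCount φ d fun _ => none := by simpa [State.init] using z
  apply runs_of_wp (block [.const 1 N, .sub 1 1 0, .branch 1 (.const 0 0) (.const 0 1)])
  simp only [block, wp, reg_setReg, z', reduceIte, zero_ne_one]
  exact ⟨hN,
    fun h => ⟨Nat.zero_le _, fun h' => absurd (Nat.sub_eq_zero_of_le h') h, fun _ => trivial⟩,
    fun h => ⟨by omega, fun _ => trivial, fun h' => absurd (Nat.le_of_sub_eq_zero h) h'⟩⟩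

end Correctness

/-! ### One constant for all thresholds of bounded denominator -/

theorem exists_solvesThr {ρ : ℚ} (hρ : 0 < ρ) :
    ∃ C : ℕ, ∀ C' ≥ C, ∃ p : Program, p.SolvesThr ρ 3 C' := by
  obtain ⟨d, N, h⟩ := exists_treeCount_threshold 3 hρ
  -- The summands cover the running time and the constants `2 ^ d` and `N`; the `9` makes words
  -- large enough for literal codes and input positions. Allowing every larger constant makes it
  -- possible to take a maximum over `ρ`.
  refine ⟨treeTime d + 2 ^ d + N + 9, fun C hC => ⟨thresholdProgram d N, fun n φ hφ => ?_⟩⟩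
  have hpow : 1 ≤ 2 ^ d := Nat.one_le_two_pow
  have hlen : 2 ≤ (encode φ).length := by simp [encode]
  have hB : C * 2 ≤ C * (n + (encode φ).length) := Nat.mul_le_mul_left _ (by omega)
  have hB' : 9 * (n + (encode φ).length) ≤ C * (n + (encode φ).length) :=
    Nat.mul_le_mul_right _ (by omega)
  obtain ⟨t, s, ht, he, hs⟩ := answers_thresholdProgram (d := d) (N := N) hφ
    (show 2 * n + 2 ≤ C * (n + (encode φ).length) by omega) (by omega) (by omega) (by omega)
    (by omega)
  rw [← h n φ hφ] at hs
  exact ⟨t, s, ht.trans (Nat.mul_le_mul_right _ (by omega)), he, hs⟩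

theorem finite_den_le (M : ℕ) : {ρ : ℚ | 0 < ρ ∧ ρ < 1 ∧ ρ.den ≤ M}.Finite := by
  refine Set.Finite.subset (((Set.finite_Icc (0 : ℤ) M).prod (Set.finite_Icc 0 M)).image
    fun p : ℤ × ℕ => (p.1 / p.2 : ℚ)) ?_
  rintro ρ ⟨h0, h1, hM⟩
  refine ⟨(ρ.num, ρ.den), ⟨⟨(Rat.num_pos.2 h0).le, ?_⟩, ⟨Nat.zero_le _, hM⟩⟩, ρ.num_div_den⟩
  have := Rat.num_lt_denom_iff.2 h1
  change ρ.num ≤ M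
  omega

end ThresholdSAT

theorem mainTheorem10 (M : ℕ) (hM : 0 < M) :
    ∃ C : ℕ, ∀ ρ : ℚ, 0 < ρ → ρ < 1 → ρ.den ≤ M →
      ∃ p : ThresholdSAT.Program, p.SolvesThr ρ 3 C := by
  choose! C hC using fun (ρ : ℚ) (hρ : 0 < ρ) => ThresholdSAT.exists_solvesThr hρ
  obtain ⟨K, hK⟩ := ((ThresholdSAT.finite_den_le M).image C).bddAbove
  exact ⟨K, fun ρ h0 h1 hM => hC ρ h0 K (hK ⟨ρ, ⟨h0, h1, hM⟩, rfl⟩)⟩
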